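/- Let $V$, $E$, $F$ be real normed vector spaces (for instance finite-dimensional ones), let $M\subseteq V$ be open (for instance $M=V$), and let $S : V\to \mathrm{Hom}(E,F)$ be a continuous linear map, regarded as a constant $\mathrm{Hom}(E,F)$-valued one-form on $M$. Let $A^i=\Lambda^i\otimes E$ and $B^i=\Lambda^i\otimes F$ be the spaces of smooth $E$-valued and $F$-valued differential $i$-forms on $M$ ($i\ge 0$), with the exterior derivative $\mathrm d$, and let $S^i:A^i\to B^{i+1}$ be $u\mapsto S\wedge u$, that is $(S\wedge u)(v_0,\dots,v_i)=\sum_k(-1)^kS(v_k)\,u(v_0,\dots,\widehat{v_k},\dots,v_i)$; it satisfies $\mathrm dS^i=-S^{i+1}\mathrm d$. Let $Z_S^\bullet$ be the mapping cone, $Z_S^i=B^i\oplus A^i$, with differential $\mathrm d_S=\begin{bmatrix}\mathrm d&S^i\\0&\mathrm d\end{bmatrix}$, and let $Z_0^\bullet$ be the same with $S=0$. Let $R:V\to\mathrm{Hom}(E,F)$ be the contraction of $S$ by the identity vector field, $R(x)=S(x)$, and put $$Q(x)=\begin{bmatrix}I_F&-R(x)\\0&I_E\end{bmatrix},\qquad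 Q(x)^{-1}=\begin{bmatrix}I_F&R(x)\\0&I_E\end{bmatrix}.$$ Then: 1. $\mathrm DR=S$. The differential $\mathrm d_S$ is the covariant exterior derivative $u\mapsto \mathrm du+A_S\wedge u$ of the connection one-form $A_S=\begin{bmatrix}0&S\\0&0\end{bmatrix}$ on forms with values in $F\oplus E$, and $A_S$ is the gauge transform $Q\,A\,Q^{-1}-(\mathrm DQ)Q^{-1}$ of the trivial connection one-form $A=0$ by $Q$. 2. The map $u\mapsto Qu$ (pointwise action of $Q(x)$ on the values of the form) is an isomorphism of complexes $Z_0^\bullet\to Z_S^\bullet$, with inverse $u\mapsto Q^{-1}u$. In particular it induces isomorphisms $\mathcal H^i(Z_0^\bullet)\cong\mathcal H^i(Z_S^\bullet)$ for all $i$. 3. The map $\mathcal H^i(A^\bullet)\to\mathcal H^{i+1}(B^\bullet)$, $[u]\mapsto[S\wedge u]$, induced by $S$ on cohomology is zero for every $i\ge 0$. -/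

import Mathlib

open CategoryTheory
open scoped ContDiff

universe u

noncomputable section

namespace TwistedDeRham

section Forms

variable {V E F G : Type u}
  [NormedAddCommGroup V] [NormedSpace ℝ V] [NormedAddCommGroup E] [NormedSpace ℝ E]
  [NormedAddCommGroup F] [NormedSpace ℝ F] [NormedAddCommGroup G] [NormedSpace ℝ G]

/-- The space `Λ^i ⊗ E` of smooth `E`-valued differential `i`-forms on the open set `M` of `V`.
A form on `M` is represented by its extension by zero to `V`, so that two elements are equal if and
only if they agree on `M`; smoothness is required on `M` only. -/
def Form (M : TopologicalSpace.Opens V) (E : Type u) [NormedAddCommGroup E] [NormedSpace ℝ E]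
    (i : ℕ) : Submodule ℝ (V → V [⋀^Fin i]→L[ℝ] E) where
  carrier := {w | ContDiffOn ℝ ∞ w M ∧ ∀ x ∉ M, w x = 0}
  add_mem' := fun ha hb => ⟨ha.1.add hb.1, fun x hx => by simp [ha.2 x hx, hb.2 x hx]⟩
  zero_mem' := ⟨contDiffOn_const, fun _ _ => rfl⟩
  smul_mem' := fun c _ ha => ⟨ha.1.const_smul c, fun x hx => by simp [ha.2 x hx]⟩

variable {M : TopologicalSpace.Opens V} {i : ℕ}

theorem Form.differentiableAt (w : Form M E i) {x : V} (hx : x ∈ M) :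
    DifferentiableAt ℝ w.1 x :=
  (w.2.1.contDiffAt (M.isOpen.mem_nhds hx)).differentiableAt (by simp)

theorem Form.ext_on {w η : Form M E i} (h : ∀ x ∈ M, w.1 x = η.1 x) : w = η := by
  refine Subtype.ext (funext fun x => ?_)
  by_cases hx : x ∈ M
  · exact h x hx
  · rw [w.2.2 x hx, η.2.2 x hx]

open Classical in
/-- The exterior derivative `d` of `E`-valued forms on `M`. -/
def extD (M : TopologicalSpace.Opens V) (E : Type u) [NormedAddCommGroup E] [NormedSpace ℝ E]
    (i : ℕ) : Form M E i →ₗ[ℝ] Form M E (i + 1) where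
  toFun w := ⟨fun x => if x ∈ M then extDeriv w.1 x else 0, by
    constructor
    · have h : ContDiffOn ℝ ∞ (extDeriv w.1) M :=
        (ContinuousAlternatingMap.alternatizeUncurryFinCLM ℝ V E).contDiff.comp_contDiffOn
          (w.2.1.fderiv_of_isOpen M.isOpen (by simp))
      exact h.congr fun x hx => if_pos hx
    · intro x hx
      exact if_neg hx⟩
  map_add' w η := by
    refine Form.ext_on fun x hx => ?_
    simp [hx, extDeriv_add (Form.differentiableAt w hx) (Form.differentiableAt η hx)]
  map_smul' c w := by
    refine Form.ext_on fun x hx => ?_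
    simp [hx, extDeriv_smul]

theorem extD_apply (w : Form M E i) {x : V} (hx : x ∈ M) :
    (extD M E i w).1 x = extDeriv w.1 x := by
  simp [extD, hx]

theorem extD_extD (w : Form M E i) : extD M E (i + 1) (extD M E i w) = 0 := by
  refine Form.ext_on fun x hx => ?_
  have hev : (extD M E i w).1 =ᶠ[nhds x] extDeriv w.1 :=
    Filter.eventually_of_mem (M.isOpen.mem_nhds hx) fun y hy => extD_apply w hy
  rw [extD_apply _ hx, hev.extDeriv_eq,
    extDeriv_extDeriv_apply (w.2.1.contDiffAt (M.isOpen.mem_nhds hx))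
      (by rw [minSmoothness_of_isRCLikeNormedField]; exact WithTop.coe_le_coe.2 le_top)]
  rfl

/-- The wedge product `a ∧ w` of a `Hom(E, F)`-valued covector `a` with an `E`-valued alternating
form `w`, evaluating endomorphisms on vectors:
`(a ∧ w)(v₀, …, vᵢ) = ∑ₖ (-1)ᵏ a(vₖ) (w(v₀, …, v̂ₖ, …, vᵢ))`. -/
def wedge (i : ℕ) (a : V →L[ℝ] E →L[ℝ] F) : (V [⋀^Fin i]→L[ℝ] E) →L[ℝ] (V [⋀^Fin (i + 1)]→L[ℝ] F) :=
  ContinuousAlternatingMap.alternatizeUncurryFinCLM ℝ V F ∘L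
    (ContinuousLinearMap.compContinuousAlternatingMapCLM ℝ V E F (Fin i) ∘L a).flip

theorem wedge_apply (a : V →L[ℝ] E →L[ℝ] F) (w : V [⋀^Fin i]→L[ℝ] E) (v : Fin (i + 1) → V) :
    wedge i a w v = ∑ k : Fin (i + 1), (-1) ^ (k : ℕ) • a (v k) (w (k.removeNth v)) := by
  simp [wedge, ContinuousAlternatingMap.alternatizeUncurryFin_apply]

/-- The map `S^i : A^i → B^{i+1}`, `u ↦ S ∧ u`, for a constant `S ∈ Λ¹ ⊗ Hom(E, F)`. -/
def wedgeS (M : TopologicalSpace.Opens V) (S : V →L[ℝ] E →L[ℝ] F) (i : ℕ) :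
    Form M E i →ₗ[ℝ] Form M F (i + 1) where
  toFun w := ⟨fun x => wedge i S (w.1 x),
    (wedge i S).contDiff.comp_contDiffOn w.2.1, fun x hx => by simp [w.2.2 x hx]⟩
  map_add' w η := Form.ext_on fun x _ => by simp
  map_smul' c w := Form.ext_on fun x _ => by simp

theorem extD_wedgeS (S : V →L[ℝ] E →L[ℝ] F) (w : Form M E i) :
    extD M F (i + 1) (wedgeS M S i w) = -wedgeS M S (i + 1) (extD M E i w) := by
  rw [eq_neg_iff_add_eq_zero]
  refine Form.ext_on fun x hx => ?_
  have h1 : (extD M F (i + 1) (wedgeS M S i w)).1 x =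
      ContinuousAlternatingMap.alternatizeUncurryFin ((wedge i S) ∘L fderiv ℝ w.1 x) := by
    rw [extD_apply _ hx, extDeriv]
    congr 1
    exact ((wedge i S).hasFDerivAt.comp x (Form.differentiableAt w hx).hasFDerivAt).fderiv
  have h2 : (wedgeS M S (i + 1) (extD M E i w)).1 x = wedge (i + 1) S (extDeriv w.1 x) := by
    rw [← extD_apply _ hx]; rfl
  let C := ContinuousLinearMap.compContinuousAlternatingMapCLM ℝ V E F (Fin i) ∘L S
  let f : V →L[ℝ] V →L[ℝ] V [⋀^Fin i]→L[ℝ] F :=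
    (ContinuousLinearMap.compL ℝ V (V [⋀^Fin i]→L[ℝ] E) (V [⋀^Fin i]→L[ℝ] F)).flip
      (fderiv ℝ w.1 x) ∘L C
  have h3 := ContinuousAlternatingMap.alternatizeUncurryFin_alternatizeUncurryFinCLM_comp_of_symmetric
    (f := f + f.flip) (fun x y => by simp [add_comm])
  have h4 : wedge (i + 1) S (extDeriv w.1 x) = ContinuousAlternatingMap.alternatizeUncurryFin
      (ContinuousAlternatingMap.alternatizeUncurryFinCLM ℝ V F ∘L f) := by
    ext v
    rw [wedge_apply, ContinuousAlternatingMap.alternatizeUncurryFin_apply]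
    simp [extDeriv, ContinuousAlternatingMap.alternatizeUncurryFin_apply, f, C]
  have h5 : (wedge i S) ∘L fderiv ℝ w.1 x =
      ContinuousAlternatingMap.alternatizeUncurryFinCLM ℝ V F ∘L f.flip := by
    ext v w
    simp [wedge, ContinuousAlternatingMap.alternatizeUncurryFin_apply, f, C]
  change (extD M F (i + 1) (wedgeS M S i w)).1 x + (wedgeS M S (i + 1) (extD M E i w)).1 x = 0
  rw [h1, h2, h4, h5, ← ContinuousAlternatingMap.alternatizeUncurryFin_add,
    ← ContinuousLinearMap.comp_add, add_comm f.flip, h3]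

/-- The differential `d_S = [[d, S], [0, d]]` of the mapping cone, acting on `B^i ⊕ A^i`. -/
def coneD (M : TopologicalSpace.Opens V) (S : V →L[ℝ] E →L[ℝ] F) (i : ℕ) :
    (Form M F i × Form M E i) →ₗ[ℝ] (Form M F (i + 1) × Form M E (i + 1)) where
  toFun z := (extD M F i z.1 + wedgeS M S i z.2, extD M E i z.2)
  map_add' y z := by
    simp only [Prod.fst_add, Prod.snd_add, map_add, Prod.mk_add_mk, Prod.mk.injEq, and_true]
    abel
  map_smul' c z := by simp

theorem coneD_coneD (S : V →L[ℝ] E →L[ℝ] F) (z : Form M F i × Form M E i) :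
    coneD M S (i + 1) (coneD M S i z) = 0 := by
  simp [coneD, extD_extD, extD_wedgeS]

/-- The de Rham complex `Λ^• ⊗ E` on `M`. -/
def deRham (M : TopologicalSpace.Opens V) (E : Type u) [NormedAddCommGroup E] [NormedSpace ℝ E] :
    CochainComplex (ModuleCat.{u} ℝ) ℕ :=
  CochainComplex.of (fun i => ModuleCat.of ℝ (Form M E i)) (fun i => ModuleCat.ofHom (extD M E i))
    (fun _ => by ext1; exact LinearMap.ext extD_extD)

theorem deRham_d (M : TopologicalSpace.Opens V) (i : ℕ) :
    (deRham M E).d i (i + 1) = ModuleCat.ofHom (extD M E i) :=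
  CochainComplex.of_d (fun i => ModuleCat.of ℝ (Form M E i)) (fun i => ModuleCat.ofHom (extD M E i)) i

/-- The mapping cone `Z_S^•`, `Z_S^i = B^i ⊕ A^i`, with differential `d_S`. -/
def cone (M : TopologicalSpace.Opens V) (S : V →L[ℝ] E →L[ℝ] F) :
    CochainComplex (ModuleCat.{u} ℝ) ℕ :=
  CochainComplex.of (fun i => ModuleCat.of ℝ (Form M F i × Form M E i))
    (fun i => ModuleCat.ofHom (coneD M S i))
    (fun _ => by ext1; exact LinearMap.ext (coneD_coneD S))

/-- The identification `(Λ^i ⊗ F) ⊕ (Λ^i ⊗ E) = Λ^i ⊗ (F ⊕ E)`. -/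
def joined (z : Form M F i × Form M E i) : V → V [⋀^Fin i]→L[ℝ] (F × E) :=
  fun x => (z.1.1 x).prod (z.2.1 x)

end Forms

section Gauge

variable {V E F G : Type u}
  [NormedAddCommGroup V] [NormedSpace ℝ V] [NormedAddCommGroup E] [NormedSpace ℝ E]
  [NormedAddCommGroup F] [NormedSpace ℝ F] [NormedAddCommGroup G] [NormedSpace ℝ G]

/-- The covariant exterior derivative `d_A u = du + A ∧ u` of the connection one-form `A`. -/
def covExtDeriv {i : ℕ} (A : V → V →L[ℝ] G →L[ℝ] G) (w : V → V [⋀^Fin i]→L[ℝ] G) (x : V) :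
    V [⋀^Fin (i + 1)]→L[ℝ] G :=
  extDeriv w x + wedge i (A x) (w x)

/-- The gauge transform `Q A Q⁻¹ - (DQ) Q⁻¹` of the connection one-form `A`, evaluated at the point
`x` on the tangent vector `v`. -/
def gaugeTransform (Q : V → G ≃L[ℝ] G) (A : V → V →L[ℝ] G →L[ℝ] G) (x v : V) : G →L[ℝ] G :=
  (Q x : G →L[ℝ] G) ∘L A x v ∘L ((Q x).symm : G →L[ℝ] G) -
    fderiv ℝ (fun y => (Q y : G →L[ℝ] G)) x v ∘L ((Q x).symm : G →L[ℝ] G)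

/-- The block matrix `[[0, T], [0, 0]]` acting on `F ⊕ E`. -/
def upper (T : E →L[ℝ] F) : F × E →L[ℝ] F × E :=
  ContinuousLinearMap.inl ℝ F E ∘L T ∘L ContinuousLinearMap.snd ℝ F E

/-- The constant connection one-form `[[0, S], [0, 0]]`. -/
def connectionForm (S : V →L[ℝ] E →L[ℝ] F) (_x : V) : V →L[ℝ] (F × E →L[ℝ] F × E) :=
  LinearMap.mkContinuous
    { toFun := fun v => upper (S v)
      map_add' := fun v w => by ext <;> simp [upper]
      map_smul' := fun c v => by ext <;> simp [upper] } ‖S‖ (fun v => by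
        refine ContinuousLinearMap.opNorm_le_bound _ (by positivity) fun z => ?_
        have h1 : ‖S v z.2‖ ≤ ‖S‖ * ‖v‖ * ‖z.2‖ := S.le_opNorm₂ v z.2
        have h2 : ‖z.2‖ ≤ ‖z‖ := norm_snd_le z
        have h3 : ‖S‖ * ‖v‖ * ‖z.2‖ ≤ ‖S‖ * ‖v‖ * ‖z‖ := by gcongr
        simpa [upper, Prod.norm_def] using h1.trans h3)

/-- The block matrix `[[I, R(x)], [0, I]]` acting on `F ⊕ E`, with inverse `[[I, -R(x)], [0, I]]`. -/
def unipotent (R : V → E →L[ℝ] F) (x : V) : (F × E) ≃L[ℝ] (F × E) :=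
  ContinuousLinearEquiv.equivOfInverse
    (ContinuousLinearMap.id ℝ (F × E) + upper (R x))
    (ContinuousLinearMap.id ℝ (F × E) - upper (R x))
    (fun z => by simp [upper]) (fun z => by simp [upper])

/-- The contraction `x ↦ w(x)(ξ(x))` of a one-form by a vector field. -/
def contract {W : Type u} [NormedAddCommGroup W] [NormedSpace ℝ W]
    (w : V → V →L[ℝ] W) (ξ : V → V) (x : V) : W :=
  w x (ξ x)

end Gauge

section Cohomology

/-- The map on cocycles `ker d^i ⊆ K^i → ker d^{i+1} ⊆ L^{i+1}`, `u ↦ f u`, given by a family of maps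
`f i : K^i → L^{i+1}` that anticommutes with the differentials. -/
def inducedOnCocycles {K L : CochainComplex (ModuleCat.{u} ℝ) ℕ}
    (f : ∀ i, K.X i ⟶ L.X (i + 1))
    (hf : ∀ i, f i ≫ L.d (i + 1) (i + 2) = -(K.d i (i + 1) ≫ f (i + 1))) (i : ℕ) :
    K.cycles i ⟶ L.cycles (i + 1) :=
  L.liftCycles (K.iCycles i ≫ f i) (i + 2) (by simp) (by rw [Category.assoc, hf]; simp)

theorem toCycles_inducedOnCocycles {K L : CochainComplex (ModuleCat.{u} ℝ) ℕ}
    (f : ∀ i, K.X i ⟶ L.X (i + 1))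
    (hf : ∀ i, f i ≫ L.d (i + 1) (i + 2) = -(K.d i (i + 1) ≫ f (i + 1))) (i j : ℕ) :
    K.toCycles j i ≫ inducedOnCocycles f hf i ≫ L.homologyπ (i + 1) = 0 := by
  by_cases h : (ComplexShape.up ℕ).Rel j i
  · obtain rfl : j + 1 = i := h
    rw [← Category.assoc, inducedOnCocycles, HomologicalComplex.comp_liftCycles]
    refine L.liftCycles_homologyπ_eq_zero_of_boundary _ _ _ (i' := j + 1) (-f j) ?_
    rw [← Category.assoc, K.toCycles_i, Preadditive.neg_comp, hf, neg_neg]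
  · rw [K.toCycles_eq_zero h, Limits.zero_comp]

/-- The map `H^i(K) → H^{i+1}(L)`, `[u] ↦ [f u]`, induced on cohomology by a family of maps
`f i : K^i → L^{i+1}` that anticommutes with the differentials. -/
def inducedOnCohomology {K L : CochainComplex (ModuleCat.{u} ℝ) ℕ}
    (f : ∀ i, K.X i ⟶ L.X (i + 1))
    (hf : ∀ i, f i ≫ L.d (i + 1) (i + 2) = -(K.d i (i + 1) ≫ f (i + 1))) (i : ℕ) :
    K.homology i ⟶ L.homology (i + 1) :=
  (K.sc i).descHomology (inducedOnCocycles f hf i ≫ L.homologyπ (i + 1))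
    (toCycles_inducedOnCocycles f hf i _)

variable {V E F : Type u}
  [NormedAddCommGroup V] [NormedSpace ℝ V] [NormedAddCommGroup E] [NormedSpace ℝ E]
  [NormedAddCommGroup F] [NormedSpace ℝ F]

/-- The map `H^i(A^•) → H^{i+1}(B^•)`, `[u] ↦ [S ∧ u]`, induced by `S` on cohomology. -/
def cohomologyS (M : TopologicalSpace.Opens V) (S : V →L[ℝ] E →L[ℝ] F) (i : ℕ) :
    (deRham M E).homology i ⟶ (deRham M F).homology (i + 1) :=
  inducedOnCohomology (K := deRham M E) (L := deRham M F)
    (fun i => ModuleCat.ofHom (wedgeS M S i))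
    (fun i => by
      rw [deRham_d, deRham_d]
      ext1
      exact LinearMap.ext (extD_wedgeS S)) i

end Cohomology

end TwistedDeRham

end

namespace TwistedDeRham

section Contraction

variable {V E F : Type u}
  [NormedAddCommGroup V] [NormedSpace ℝ V] [NormedAddCommGroup E] [NormedSpace ℝ E]
  [NormedAddCommGroup F] [NormedSpace ℝ F] {M : TopologicalSpace.Opens V} {i : ℕ}

/-! Everything follows from one Leibniz rule. Since `R x = S x` is linear in `x`, its derivative is
the constant `S`, so d(R u) = S ∧ u + R du (`extD_applyForm`). Thus S ∧ · = dR - Rd: the family u ↦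
R u is a contracting homotopy for wedging with `S`. For closed u this gives S ∧ u = d(R u), so the
map on cohomology vanishes. Read on the cone, the same identity says that the shear (b, a) ↦ (b + R
a, a) changes the twist of the differential by `S` (`coneD_shear`), so shearing by `-S` carries the
untwisted cone to that of `S`. -/

/-- Pointwise application of `S x` to the value at `x` of an `E`-valued form. -/
noncomputable def applyForm (M : TopologicalSpace.Opens V) (S : V →L[ℝ] E →L[ℝ] F) (i : ℕ) :
    Form M E i →ₗ[ℝ] Form M F i where
  toFun w := ⟨fun x => ContinuousLinearMap.compContinuousAlternatingMapCLM ℝ V E F (Fin i)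
      (S x) (w.1 x),
    ((ContinuousLinearMap.compContinuousAlternatingMapCLM ℝ V E F (Fin i)) ∘L
      S).contDiff.contDiffOn.clm_apply w.2.1, fun x hx => by simp only [w.2.2 x hx, map_zero]⟩
  map_add' w η := Form.ext_on fun x _ => by
    simp only [Submodule.coe_add, Pi.add_apply, map_add]
  map_smul' c w := Form.ext_on fun x _ => by
    simp only [Submodule.coe_smul, Pi.smul_apply, map_smul, RingHom.id_apply]

theorem applyForm_apply (S : V →L[ℝ] E →L[ℝ] F) (w : Form M E i) (x : V) :
    (applyForm M S i w).1 x = (S x).compContinuousAlternatingMap (w.1 x) :=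
  rfl

/-- The Leibniz rule `d(R u) = S ∧ u + R du` for `R x = S x`. -/
theorem extD_applyForm (S : V →L[ℝ] E →L[ℝ] F) (w : Form M E i) :
    extD M F i (applyForm M S i w) = wedgeS M S i w + applyForm M S (i + 1) (extD M E i w) := by
  refine Form.ext_on fun x hx => ?_
  -- Product rule for the bilinear pairing of R with the form: after alternatization, the derivative
  -- of R gives S ∧ u and the derivative of the form gives R du.
  have hC := ((ContinuousLinearMap.compContinuousAlternatingMapCLM ℝ V E F (Fin i)) ∘L
    S).hasFDerivAt (x := x)
  have h := (hC.clm_apply (Form.differentiableAt w hx).hasFDerivAt).fderiv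
  change _ = wedge i S (w.1 x) + (applyForm M S (i + 1) (extD M E i w)).1 x
  rw [extD_apply _ hx, applyForm_apply, extD_apply _ hx, extDeriv]
  erw [h]
  ext v
  simp [wedge_apply, extDeriv, ContinuousAlternatingMap.alternatizeUncurryFin_apply,
    add_comm]

/-! ### Shears of the mapping cone -/

/-- The shear `(b, a) ↦ (b + R a, a)` of the cone in degree `i`, where `R x = S x`. -/
noncomputable def shear (M : TopologicalSpace.Opens V) (S : V →L[ℝ] E →L[ℝ] F) (i : ℕ) :
    (Form M F i × Form M E i) →ₗ[ℝ] (Form M F i × Form M E i) :=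
  (LinearMap.fst ℝ _ _ + applyForm M S i ∘ₗ LinearMap.snd ℝ _ _).prod (LinearMap.snd ℝ _ _)

theorem shear_apply (S : V →L[ℝ] E →L[ℝ] F) (z : Form M F i × Form M E i) :
    shear M S i z = (z.1 + applyForm M S i z.2, z.2) :=
  rfl

theorem applyForm_neg (S : V →L[ℝ] E →L[ℝ] F) (w : Form M E i) :
    applyForm M (-S) i w = -applyForm M S i w :=
  Form.ext_on fun x _ => by
    change (applyForm M (-S) i w).1 x = -(applyForm M S i w).1 x
    ext v
    simp [applyForm_apply]

/-- The Leibniz term S ∧ a joins T ∧ a to make U ∧ a. Keeping `T + S = U` as a hypothesis makes both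
directions of the isomorphism instances of one lemma: (T, S, U) = (S, -S, 0) and (0, S, S). -/
theorem coneD_shear {S T U : V →L[ℝ] E →L[ℝ] F} (h : T + S = U)
    (z : Form M F i × Form M E i) :
    coneD M T i (shear M S i z) = shear M S (i + 1) (coneD M U i z) := by
  have hw : wedgeS M U i z.2 = wedgeS M T i z.2 + wedgeS M S i z.2 :=
    Form.ext_on fun x _ => by
      change wedge i U (z.2.1 x) = wedge i T (z.2.1 x) + wedge i S (z.2.1 x)
      ext v
      simp [wedge_apply, ← h, Finset.sum_add_distrib]
  refine Prod.ext ?_ rfl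
  simp only [shear_apply, coneD, LinearMap.coe_mk, AddHom.coe_mk, map_add,
    extD_applyForm, hw]
  abel

theorem joined_shear (S : V →L[ℝ] E →L[ℝ] F) (z : Form M F i × Form M E i) (x : V) :
    joined (shear M S i z) x =
      (unipotent S x : F × E →L[ℝ] F × E).compContinuousAlternatingMap (joined z x) := by
  ext v <;> simp [joined, shear_apply, applyForm_apply, unipotent, upper]

theorem cone_d (M : TopologicalSpace.Opens V) (S : V →L[ℝ] E →L[ℝ] F) (i : ℕ) :
    (cone M S).d i (i + 1) = ModuleCat.ofHom (coneD M S i) :=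
  CochainComplex.of_d (fun i => ModuleCat.of ℝ (Form M F i × Form M E i))
    (fun i => ModuleCat.ofHom (coneD M S i)) i

/-- The shear by `S`, as a morphism of cones. -/
noncomputable def shearHom (M : TopologicalSpace.Opens V) {S T U : V →L[ℝ] E →L[ℝ] F} (h : T + S = U) :
    cone M U ⟶ cone M T where
  f i := ModuleCat.ofHom (shear M S i)
  comm' i j hij := by
    obtain rfl : i + 1 = j := hij
    rw [cone_d, cone_d]
    ext1
    exact LinearMap.ext (coneD_shear h)

theorem shearHom_comp {S T U : V →L[ℝ] E →L[ℝ] F} (h : T + S = U) (h' : U + -S = T) :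
    shearHom M h ≫ shearHom M h' = 𝟙 (cone M U) := by
  refine HomologicalComplex.hom_ext _ _ fun i => ?_
  change ModuleCat.ofHom (shear M S i) ≫ ModuleCat.ofHom (shear M (-S) i) = 𝟙 _
  ext1
  refine LinearMap.ext fun z => Prod.ext ?_ rfl
  change z.1 + applyForm M S i z.2 + applyForm M (-S) i z.2 = z.1
  rw [applyForm_neg, add_neg_cancel_right]

/-- The isomorphism of the untwisted cone with the cone of `S`, given by `(b, a) ↦ (b - R a, a)`. -/
noncomputable def gaugeIso (M : TopologicalSpace.Opens V) (S : V →L[ℝ] E →L[ℝ] F) :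
    cone M (0 : V →L[ℝ] E →L[ℝ] F) ≅ cone M S where
  hom := shearHom M (S := -S) (add_neg_cancel S)
  inv := shearHom M (S := S) (zero_add S)
  hom_inv_id := by
    -- The returning shear is by `-(-S)` here and must be rewritten to the shear by `S`.
    have := shearHom_comp (M := M) (add_neg_cancel S) (by simp)
    simpa only [neg_neg] using this
  inv_hom_id := shearHom_comp (M := M) (zero_add S) (add_neg_cancel S)

/-! ### The connection form and its gauge transform -/

/-- The exterior derivative acts componentwise on F ⊕ E, and [[0, S], [0, 0]] sends (b, a) to (S a,
0), so the wedge term only enters the F-component. -/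
theorem joined_coneD (S : V →L[ℝ] E →L[ℝ] F) (z : Form M F i × Form M E i) {x : V} (hx : x ∈ M) :
    joined (coneD M S i z) x = covExtDeriv (connectionForm S) (joined z) x := by
  have hd : HasFDerivAt (joined z)
      ((ContinuousAlternatingMap.prodLIE ℝ V F E (ι := Fin i)).toContinuousLinearEquiv ∘L
        (fderiv ℝ z.1.1 x).prod (fderiv ℝ z.2.1 x)) x :=
    (ContinuousLinearEquiv.hasFDerivAt
      (ContinuousAlternatingMap.prodLIE ℝ V F E (ι := Fin i)).toContinuousLinearEquiv).comp x
      ((Form.differentiableAt z.1 hx).hasFDerivAt.prodMk (Form.differentiableAt z.2 hx).hasFDerivAt)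
  have h1 : (coneD M S i z).1.1 x = extDeriv z.1.1 x + wedge i S (z.2.1 x) := by
    rw [← extD_apply _ hx]; rfl
  have h2 : (coneD M S i z).2.1 x = extDeriv z.2.1 x := extD_apply _ hx
  rw [joined, h1, h2, covExtDeriv, extDeriv, extDeriv, extDeriv, hd.fderiv]
  ext v
  · simp [ContinuousAlternatingMap.alternatizeUncurryFin_apply, wedge_apply, Prod.fst_sum,
      connectionForm, upper, joined, ContinuousAlternatingMap.prodLIE]
    rfl
  · simp [ContinuousAlternatingMap.alternatizeUncurryFin_apply, wedge_apply, Prod.snd_sum,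
      connectionForm, upper, joined, ContinuousAlternatingMap.prodLIE]
    rfl

theorem hasFDerivAt_unipotent {R : V → E →L[ℝ] F} {R' : V →L[ℝ] E →L[ℝ] F} {x : V}
    (h : HasFDerivAt R R' x) :
    HasFDerivAt (fun y => (unipotent R y : F × E →L[ℝ] F × E)) (connectionForm R' x) x := by
  -- `U` is `upper` as a continuous linear map, so the unipotent matrix is an affine function of R.
  let U : (E →L[ℝ] F) →L[ℝ] (F × E →L[ℝ] F × E) :=
    (ContinuousLinearMap.compL ℝ (F × E) F (F × E) (ContinuousLinearMap.inl ℝ F E)) ∘L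
      (ContinuousLinearMap.compL ℝ (F × E) E F).flip (ContinuousLinearMap.snd ℝ F E)
  have hU := (U.hasFDerivAt.comp x h).const_add (ContinuousLinearMap.id ℝ (F × E))
  exact hU

/-- For A = 0 only -(DQ)Q⁻¹ remains. DQ depends on the E-component alone, which Q⁻¹ leaves fixed, so
(DQ)Q⁻¹ = DQ. -/
theorem gaugeTransform_unipotent_zero {R : V → E →L[ℝ] F} {R' : V →L[ℝ] E →L[ℝ] F} {x : V}
    (h : HasFDerivAt R R' x) (v : V) :
    gaugeTransform (unipotent R) 0 x v = connectionForm (-R') x v := by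
  rw [gaugeTransform, (hasFDerivAt_unipotent h).fderiv]
  have hs (z : F × E) : ((unipotent R x).symm z).2 = z.2 := by
    change (z - upper (R x) z).2 = z.2
    simp [upper]
  ext z <;> simp [connectionForm, upper, hs]

/-! ### The induced map on cohomology -/

theorem cohomologyS_eq_zero (M : TopologicalSpace.Opens V) (S : V →L[ℝ] E →L[ℝ] F) (i : ℕ) :
    cohomologyS M S i = 0 := by
  -- Cocycles surject onto cohomology, so it suffices to exhibit, for each cocycle u, a primitive of
  -- S ∧ u; the primitive is R u.
  rw [← cancel_epi ((deRham M E).homologyπ i), Limits.comp_zero]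
  refine (ShortComplex.π_descHomology _ _ _).trans ?_
  refine (deRham M F).liftCycles_homologyπ_eq_zero_of_boundary _ _ _ (i' := i)
    ((deRham M E).iCycles i ≫ ModuleCat.ofHom (applyForm M S i)) ?_
  let W (j : ℕ) : (deRham M E).X j ⟶ (deRham M F).X (j + 1) := ModuleCat.ofHom (wedgeS M S j)
  let P (j : ℕ) : (deRham M E).X j ⟶ (deRham M F).X j := ModuleCat.ofHom (applyForm M S j)
  -- The Leibniz rule as a homotopy formula; its second term vanishes on cocycles.
  have h : W i = P i ≫ (deRham M F).d i (i + 1) - (deRham M E).d i (i + 1) ≫ P (i + 1) := by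
    rw [deRham_d, deRham_d]
    ext1
    exact LinearMap.ext fun w => eq_sub_of_add_eq (extD_applyForm S w).symm
  change (deRham M E).iCycles i ≫ W i = ((deRham M E).iCycles i ≫ P i) ≫ (deRham M F).d i (i + 1)
  rw [h, Preadditive.comp_sub, Category.assoc, HomologicalComplex.iCycles_d_assoc,
    Limits.zero_comp, sub_zero]

end Contraction

end TwistedDeRham

open TwistedDeRham CategoryTheory in
theorem mainTheorem5 {V E F : Type u}
    [NormedAddCommGroup V] [NormedSpace ℝ V] [NormedAddCommGroup E] [NormedSpace ℝ E]
    [NormedAddCommGroup F] [NormedSpace ℝ F]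
    (M : TopologicalSpace.Opens V) (S : V →L[ℝ] E →L[ℝ] F)
    (R : V → E →L[ℝ] F) (hR : R = contract (fun _ => S) (fun x => x)) :
    -- `DR = S`
    (∀ x, HasFDerivAt R S x) ∧
    -- the differential of the cone is the covariant exterior derivative of `[[0, S], [0, 0]]`
    (∀ (i : ℕ) (z : Form M F i × Form M E i), ∀ x ∈ M,
      joined (coneD M S i z) x = covExtDeriv (connectionForm S) (joined z) x) ∧
    -- the gauge transformation by `[[I, -R], [0, I]]` maps the trivial connection to that of `S`
    (∀ x v, gaugeTransform (unipotent (-R)) 0 x v = connectionForm S x v) ∧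
    -- it is an isomorphism of complexes `Z_0 ≅ Z_S`, whose inverse is `[[I, R], [0, I]]`
    (∃ Φ : cone M (0 : V →L[ℝ] E →L[ℝ] F) ≅ cone M S,
      (∀ (i : ℕ) (z : Form M F i × Form M E i), ∀ x ∈ M,
        joined (M := M) ((Φ.hom.f i).hom z) x =
          (unipotent (-R) x : F × E →L[ℝ] F × E).compContinuousAlternatingMap (joined z x)) ∧
      (∀ (i : ℕ) (z : Form M F i × Form M E i), ∀ x ∈ M,
        joined (M := M) ((Φ.inv.f i).hom z) x =
          (unipotent R x : F × E →L[ℝ] F × E).compContinuousAlternatingMap (joined z x)) ∧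
      ∀ i : ℕ, IsIso (HomologicalComplex.homologyMap Φ.hom i)) ∧
    -- `S` induces the zero map on cohomology
    (∀ i : ℕ, cohomologyS M S i = 0) := by
  subst hR
  have hD : ∀ x, HasFDerivAt (contract (fun _ => S) (fun x => x)) S x := fun x => S.hasFDerivAt
  refine ⟨hD, fun i z x hx => joined_coneD S z hx, fun x v => ?_,
    ⟨gaugeIso M S, fun i z x _ => joined_shear (-S) z x, fun i z x _ => joined_shear S z x,
      fun i => inferInstance⟩, cohomologyS_eq_zero M S⟩
  rw [gaugeTransform_unipotent_zero (hD x).neg, neg_neg]
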